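/- **Setting.** Let $d\ge 1$ and let $\Omega\subset\mathbb{R}^d$ be the probability simplex. On each trial $t=1,2,\dots$ a signal $x_t\in\mathbf X$ ($\mathbf X$ an arbitrary set) is announced, the learner predicts $\gamma_t\in\mathbb{R}^d$, and an outcome $y_t\in\Omega$ is announced. The loss is the Brier loss $\lambda(y,\gamma)=\sum_{i=1}^d(\gamma^i-y^i)^2$, and $L_T$ denotes the cumulative loss over the first $T$ trials. Let $\mathcal F$ be a reproducing kernel Hilbert space of real functions on $\mathbf X$ with kernel $K$ and finite embedding constant $c_{\mathcal F}=\sup_{x\in\mathbf X}\sup_{\|f\|_{\mathcal F}\le 1}|f(x)|<\infty$. For $f=(f_1,\dots,f_{d-1})\in\mathcal F^{d-1}$, the expert $f$ predicts $\xi_t^i=1/d+f_i(x_t)$ for $i<d$ and $\xi_t^d=1-\xi_t^1-\dots-\xi_t^{d-1}$; $L_T(f)$ is its cumulative loss. **Algorithm.** mKAAR with ridge parameter $a>0$ predicts on trial $t$ as follows. Put $\widetilde K=(K(x_s,x_u))_{s,u=1}^t$, $\widetilde k=(K(x_1,x_t),\dots,K(x_t,x_t))$, and let $A$ be the $(d-1)\times(d-1)$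 block matrix $aI+\begin{pmatrix}2\widetilde K&\cdots&\widetilde K\\ \vdots&\ddots&\vdots\\ \widetilde K&\cdots&2\widetilde K\end{pmatrix}$. For $j<d$ put $\widetilde Y_j=-2(y_1^j-y_1^d,\dots,y_{t-1}^j-y_{t-1}^d,-\tfrac12)$, and let $\overline Y_j$ be the same vector with last entry $0$. For $i<d$ let $$r_i=(\widetilde Y_1,\dots,\overline Y_i,\dots,\widetilde Y_{d-1})\,A^{-1}\,(\widetilde k,\dots,2\widetilde k,\dots,\widetilde k)'$$ ($\overline Y_i$ and $2\widetilde k$ in the $i$-th block), and $r_d=0$. Let $s\in\mathbb{R}$ be the solution of $\sum_{i=1}^d(s-r_i)^+=2$. The prediction is $\gamma_t^i=(s-r_i)^+/2$, $i=1,\dots,d$. **Statement.** Let the number of steps $T\ge1$ be known in advance and let $F>0$ be given. Then there is a ridge parameter $a>0$, fixed before the game (namely $a=c_{\mathcal F}\sqrt{(d-1)T}/F$ if $c_{\mathcal F}>0$ and $d\ge2$), such that for every sequence $(x_1,y_1),\dots,(x_T,y_T)$ of signals and outcomes, mKAAR with parameter $a$ satisfies $$L_T(\mathrm{mKAAR})\le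 L_T(f)+2c_{\mathcal F}F\sqrt{(d-1)T}$$ for all $f_1,\dots,f_{d-1}\in\mathcal F$ with $\sum_{i=1}^{d-1}\|f_i\|_{\mathcal F}^2\le F^2$. -/

import Mathlib

open scoped ENNReal

noncomputable section

/-! ### Reproducing kernel Hilbert spaces of real functions -/

/-- The norm `c_F(x) = sup {|f x| : ‖f‖ ≤ 1}` of the evaluation functional at `x`
(as an extended nonnegative number). -/
def evalNorm (H : Type*) {X : Type*} [NormedAddCommGroup H] [InnerProductSpace ℝ H]
    [RKHS ℝ H X ℝ] (x : X) : ℝ≥0∞ :=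
  ⨆ f : H, ⨆ _ : ‖f‖ ≤ 1, ENNReal.ofReal |f x|

/-- The embedding constant `c_F = sup_x c_F(x)`, possibly infinite. -/
def embeddingConst (H : Type*) {X : Type*} [NormedAddCommGroup H] [InnerProductSpace ℝ H]
    [RKHS ℝ H X ℝ] : ℝ≥0∞ :=
  ⨆ x : X, evalNorm H x

/-- The real-valued reproducing kernel `K(x, x')` of the space `H`. (Mathlib's `RKHS.kernel` takes
values in the continuous linear maps `ℝ → ℝ`; such a map is multiplication by its value at `1`.) -/
def realKernel (H : Type*) {X : Type*} [NormedAddCommGroup H] [InnerProductSpace ℝ H]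
    [CompleteSpace H] [RKHS ℝ H X ℝ] (x x' : X) : ℝ :=
  RKHS.kernel H x x' 1

/-! ### The Brier game

There are `d = m + 1` classes, indexed by `Fin (m + 1)`; the last one plays the role of the
remainder. Trials are numbered from `0`. -/

/-- The Brier loss `∑ σ, (γ{σ} - y{σ})²`. -/
def brierLoss {m : ℕ} (y γ : Fin (m + 1) → ℝ) : ℝ :=
  ∑ σ, (γ σ - y σ) ^ 2

/-- The cumulative loss over the first `T` trials of the predictions `γ` on the outcomes `y`. -/
def cumLoss {m : ℕ} (T : ℕ) (y γ : ℕ → Fin (m + 1) → ℝ) : ℝ :=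
  ∑ t ∈ Finset.range T, brierLoss (y t) (γ t)

/-- The prediction at the signal `x` of the expert given by the functions `f₁, …, f_{d-1}`:
`1/d + f_i(x)` for the first `d - 1` classes, and one minus the sum of these for the last. -/
def expertPrediction {X : Type*} {m : ℕ} (f : Fin m → X → ℝ) (x : X) : Fin (m + 1) → ℝ :=
  Fin.snoc (α := fun _ => ℝ) (fun i => 1 / ((m : ℝ) + 1) + f i x)
    (1 - ∑ i, (1 / ((m : ℝ) + 1) + f i x))

/-! ### The substitution function -/

/-- The equation `∑ i, (s - r_i)⁺ = 2` has exactly one solution `s`. -/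
theorem existsUnique_substLevel {m : ℕ} (r : Fin (m + 1) → ℝ) :
    ∃! s : ℝ, ∑ i, max (s - r i) 0 = 2 := by
  have hcont : Continuous fun s : ℝ => ∑ i, max (s - r i) 0 := by fun_prop
  obtain ⟨j, hj⟩ := Finite.exists_min r
  have h0 : ∑ i, max (r j - r i) 0 = 0 :=
    Finset.sum_eq_zero fun i _ => max_eq_right (sub_nonpos.2 (hj i))
  have h2 : 2 ≤ ∑ i, max (r j + 2 - r i) 0 := by
    have h := Finset.single_le_sum (f := fun i => max (r j + 2 - r i) 0)
      (fun i _ => le_max_right _ _) (Finset.mem_univ j)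
    have h' : r j + 2 - r j ≤ max (r j + 2 - r j) 0 := le_max_left _ _
    linarith
  obtain ⟨s, -, hs⟩ := intermediate_value_Icc (by linarith : r j ≤ r j + 2) hcont.continuousOn
    (show (2 : ℝ) ∈ Set.Icc _ _ from ⟨by rw [h0]; norm_num, h2⟩)
  have key : ∀ u v : ℝ, u < v → ∑ i, max (u - r i) 0 = 2 → ∑ i, max (v - r i) 0 ≠ 2 := by
    intro u v huv hu hv
    have hpos : ∃ i ∈ Finset.univ, 0 < max (u - r i) 0 :=
      (Finset.sum_pos_iff_of_nonneg (fun i _ => le_max_right _ _)).1 (by rw [hu]; norm_num)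
    obtain ⟨i, hi, hi0⟩ := hpos
    have hlt : ∑ i, max (u - r i) 0 < ∑ i, max (v - r i) 0 := by
      refine Finset.sum_lt_sum (fun k _ => max_le_max (by linarith) le_rfl) ⟨i, hi, ?_⟩
      have hui : 0 < u - r i := by
        rcases lt_max_iff.1 hi0 with h | h
        · exact h
        · exact absurd h (lt_irrefl _)
      rw [max_eq_left hui.le]
      exact lt_of_lt_of_le (by linarith) (le_max_left _ _)
    linarith
  refine ⟨s, hs, fun s' hs' => ?_⟩
  rcases lt_trichotomy s' s with h | h | h
  · exact absurd hs (key _ _ h hs')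
  · exact h
  · exact absurd hs' (key _ _ h hs)

/-- The solution `s` of `∑ i, (s - r_i)⁺ = 2`. -/
def substLevel {m : ℕ} (r : Fin (m + 1) → ℝ) : ℝ :=
  (existsUnique_substLevel r).choose

/-- The substitution function `γ^i = (s - r_i)⁺ / 2`. -/
def substitution {m : ℕ} (r : Fin (m + 1) → ℝ) : Fin (m + 1) → ℝ :=
  fun i => max (substLevel r - r i) 0 / 2

/-! ### The kernelized multi-dimensional Aggregating Algorithm for Regression (mKAAR)

On trial `t` the algorithm has seen the signals `x 0, …, x t` and the outcomes
`y 0, …, y (t - 1)`; only these enter the definitions below. Vectors and matrices in `d - 1 = m`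
blocks of size `t + 1` are indexed by `Fin m × Fin (t + 1)`. -/

/-- The block matrix `aI + (2K̃ on the diagonal, K̃ off the diagonal)`, with
`K̃ = (K(x_s, x_u))_{s,u ≤ t}`. -/
def mkaarMatrix {X : Type*} (m : ℕ) (K : X → X → ℝ) (a : ℝ) (x : ℕ → X) (t : ℕ) :
    Matrix (Fin m × Fin (t + 1)) (Fin m × Fin (t + 1)) ℝ :=
  a • (1 : Matrix (Fin m × Fin (t + 1)) (Fin m × Fin (t + 1)) ℝ) +
    Matrix.of fun p q => (if p.1 = q.1 then 2 else 1) * K (x p.2) (x q.2)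

/-- The row vector `(Ỹ_1, …, Ȳ_i, …, Ỹ_{d-1})`, where
`Ỹ_j = -2 (y_0^j - y_0^d, …, y_{t-1}^j - y_{t-1}^d, -1/2)` and `Ȳ_i` ends in `0` instead. -/
def mkaarRow {m : ℕ} (y : ℕ → Fin (m + 1) → ℝ) (t : ℕ) (i : Fin m) :
    Fin m × Fin (t + 1) → ℝ :=
  fun p => -2 *
    (if (p.2 : ℕ) < t then y p.2 p.1.castSucc - y p.2 (Fin.last m)
      else if p.1 = i then 0 else -1 / 2)

/-- The column vector `(k̃, …, 2k̃, …, k̃)` with `2k̃` in block `i`, where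
`k̃ = (K(x_0, x_t), …, K(x_t, x_t))`. -/
def mkaarCol {X : Type*} {m : ℕ} (K : X → X → ℝ) (x : ℕ → X) (t : ℕ) (i : Fin m) :
    Fin m × Fin (t + 1) → ℝ :=
  fun p => (if p.1 = i then 2 else 1) * K (x p.2) (x t)

/-- The shifted generalised prediction `(r_1, …, r_{d-1}, 0)` on trial `t`. -/
def mkaarShifted {X : Type*} {m : ℕ} (K : X → X → ℝ) (a : ℝ) (x : ℕ → X)
    (y : ℕ → Fin (m + 1) → ℝ) (t : ℕ) : Fin (m + 1) → ℝ :=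
  Fin.snoc (α := fun _ => ℝ)
    (fun i => mkaarRow y t i ⬝ᵥ Matrix.mulVec (mkaarMatrix m K a x t)⁻¹ (mkaarCol K x t i)) 0

/-- The prediction on trial `t` of mKAAR with kernel `K` and ridge parameter `a`. -/
def mkaar {X : Type*} {m : ℕ} (K : X → X → ℝ) (a : ℝ) (x : ℕ → X)
    (y : ℕ → Fin (m + 1) → ℝ) (t : ℕ) : Fin (m + 1) → ℝ :=
  substitution (mkaarShifted K a x y t)

end

noncomputable section

open Finset
open scoped RealInnerProductSpace Kronecker

/-- The predictions `1/d + z_i`, `i < d`, completed to a vector with coordinate sum `1`. -/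
def simplexShift {m : ℕ} (z : Fin m → ℝ) : Fin (m + 1) → ℝ :=
  Fin.snoc (α := fun _ => ℝ) (fun i => 1 / ((m : ℝ) + 1) + z i)
    (1 - ∑ i, (1 / ((m : ℝ) + 1) + z i))

lemma simplexShift_castSucc {m : ℕ} (z : Fin m → ℝ) (i : Fin m) :
    simplexShift z i.castSucc = 1 / ((m : ℝ) + 1) + z i := by
  simp [simplexShift]

lemma simplexShift_last {m : ℕ} (z : Fin m → ℝ) :
    simplexShift z (Fin.last m) = 1 / ((m : ℝ) + 1) - ∑ i, z i := by
  have : (m : ℝ) + 1 ≠ 0 := by positivity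
  simp only [simplexShift, Fin.snoc_last, sum_add_distrib, sum_const, card_univ, Fintype.card_fin,
    nsmul_eq_mul]
  field_simp
  ring

lemma brierLoss_simplexShift {m : ℕ} (y : Fin (m + 1) → ℝ) (z : Fin m → ℝ) :
    brierLoss y (simplexShift z) = ∑ σ, (1 / ((m : ℝ) + 1) - y σ) ^ 2 + ∑ i, z i ^ 2 +
      (∑ i, z i) ^ 2 - 2 * ∑ i, z i * (y i.castSucc - y (Fin.last m)) := by
  simp only [brierLoss, Fin.sum_univ_castSucc, simplexShift_castSucc, simplexShift_last]
  have h : ∀ i, (1 / ((m : ℝ) + 1) + z i - y i.castSucc) ^ 2 =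
      (1 / ((m : ℝ) + 1) - y i.castSucc) ^ 2 + z i ^ 2 + 2 * (1 / ((m : ℝ) + 1)) * z i
        - 2 * (z i * (y i.castSucc - y (Fin.last m))) - 2 * y (Fin.last m) * z i := fun i => by ring
  simp only [h, sum_add_distrib, sum_sub_distrib, ← mul_sum]
  ring

lemma brierLoss_single {m : ℕ} (i : Fin (m + 1)) (γ : Fin (m + 1) → ℝ) :
    brierLoss (Pi.single i 1) γ = ∑ σ, γ σ ^ 2 - 2 * γ i + 1 := by
  have h' : ∀ σ, (γ σ - (Pi.single i 1 : Fin (m + 1) → ℝ) σ) ^ 2 =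
      γ σ ^ 2 - (if σ = i then 2 * γ σ else 0) + (if σ = i then 1 else 0) := fun σ => by
    by_cases hσ : σ = i
    · subst hσ; simp; ring
    · simp [hσ]
  simp [brierLoss, h', sum_add_distrib, sum_sub_distrib]

/-- The Brier loss at a point of the simplex in terms of the losses at the vertices. -/
lemma brierLoss_eq_sum_vertices {m : ℕ} {y : Fin (m + 1) → ℝ}
    (hy : y ∈ stdSimplex ℝ (Fin (m + 1))) (γ : Fin (m + 1) → ℝ) :
    brierLoss y γ = ∑ i, y i * brierLoss (Pi.single i 1) γ + ∑ i, y i ^ 2 - 1 := by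
  have h2 : ∀ i, y i * (∑ σ, γ σ ^ 2 - 2 * γ i + 1) =
      y i * (∑ σ, γ σ ^ 2 + 1) - 2 * (γ i * y i) := fun i => by ring
  have h3 : ∀ i, (γ i - y i) ^ 2 = γ i ^ 2 - 2 * (γ i * y i) + y i ^ 2 := fun i => by ring
  simp only [brierLoss_single, h2]
  simp only [brierLoss, h3, sum_add_distrib, sum_sub_distrib, ← sum_mul, ← mul_sum, hy.2]
  ring

lemma substitution_mem_stdSimplex {m : ℕ} (r : Fin (m + 1) → ℝ) :
    substitution r ∈ stdSimplex ℝ (Fin (m + 1)) := by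
  refine ⟨fun i => by unfold substitution; positivity, ?_⟩
  have h : ∑ i, max (substLevel r - r i) 0 = 2 := (existsUnique_substLevel r).choose_spec.1
  simp only [substitution, ← sum_div, h]
  norm_num

/-- If `V` dominates the Brier entropy (up to `B`), then the substitution function applied to `V`,
shifted by any constant, has losses at the vertices at most `V - B`. -/
lemma brierLoss_substitution_le {m : ℕ} (V : Fin (m + 1) → ℝ) (B c : ℝ)
    (hV : ∀ p ∈ stdSimplex ℝ (Fin (m + 1)), B + 1 - ∑ i, p i ^ 2 ≤ ∑ i, p i * V i)
    (i : Fin (m + 1)) :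
    brierLoss (Pi.single i 1) (substitution fun i => V i - c) + B ≤ V i := by
  set r : Fin (m + 1) → ℝ := fun i => V i - c with hr
  have hγ := substitution_mem_stdSimplex r
  set γ := substitution r with hγdef
  set s := substLevel r
  have hmul : ∀ i, γ i * V i = γ i * (s + c) - 2 * γ i ^ 2 := fun i => by
    have hi : γ i = max (s - r i) 0 / 2 := rfl
    have hri : V i = r i + c := by simp [hr]
    rcases le_total (s - r i) 0 with h | h
    · rw [hi, max_eq_right h]; ring
    · rw [max_eq_left h] at hi
      rw [hri, show r i = s - 2 * γ i by linarith]; ring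
  have h1 := hV γ hγ
  simp only [hmul, sum_sub_distrib, ← sum_mul, ← mul_sum, hγ.2] at h1
  have h2 : s - r i ≤ 2 * γ i := by
    have : γ i = max (s - r i) 0 / 2 := rfl
    rw [this]; linarith [le_max_left (s - r i) 0]
  have h5 : r i = V i - c := rfl
  rw [brierLoss_single]
  linarith

/-- Bias-variance bound: randomised predictions `ξ + W i` for the vertex `i` drawn from `p`. -/
lemma entropy_le_sum_brierLoss {m : ℕ} {p : Fin (m + 1) → ℝ}
    (hp : p ∈ stdSimplex ℝ (Fin (m + 1))) (ξ : Fin (m + 1) → ℝ)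
    (W : Fin (m + 1) → Fin (m + 1) → ℝ) :
    1 - ∑ σ, p σ ^ 2 +
        2 * ∑ i, p i * ∑ σ, (p σ - (Pi.single i 1 : Fin (m + 1) → ℝ) σ) * W i σ ≤
      ∑ i, p i * brierLoss (Pi.single i 1) (fun σ => ξ σ + W i σ) := by
  have hsingle : ∀ σ, ∑ i, p i * (Pi.single i 1 : Fin (m + 1) → ℝ) σ = p σ := fun σ => by
    simp [Pi.single_apply]
  have hsq : ∀ i σ, ((Pi.single i 1 : Fin (m + 1) → ℝ) σ) ^ 2 =
      (Pi.single i 1 : Fin (m + 1) → ℝ) σ := fun i σ => by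
    by_cases h : σ = i
    · subst h; simp
    · simp [h]
  have key : ∀ σ, p σ - p σ ^ 2 +
      2 * ∑ i, p i * ((p σ - (Pi.single i 1 : Fin (m + 1) → ℝ) σ) * W i σ) ≤
      ∑ i, p i * (ξ σ + W i σ - (Pi.single i 1 : Fin (m + 1) → ℝ) σ) ^ 2 := fun σ => by
    have h0 : 0 ≤ ∑ i, p i * (ξ σ - p σ + W i σ) ^ 2 :=
      sum_nonneg fun i _ => mul_nonneg (hp.1 i) (sq_nonneg _)
    have h1 : ∀ i, p i * (ξ σ + W i σ - (Pi.single i 1 : Fin (m + 1) → ℝ) σ) ^ 2 =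
        p i * (ξ σ - p σ + W i σ) ^ 2 +
        2 * (p i * ((p σ - (Pi.single i 1 : Fin (m + 1) → ℝ) σ) * W i σ)) +
        (p i * (2 * (ξ σ - p σ) * p σ + p σ ^ 2) +
          p i * (Pi.single i 1 : Fin (m + 1) → ℝ) σ * (1 - 2 * (ξ σ - p σ) - 2 * p σ)) :=
      fun i => by linear_combination p i * hsq i σ
    simp only [h1, sum_add_distrib, ← sum_mul, ← mul_sum, hsingle, hp.2]
    nlinarith
  have h := sum_le_sum fun σ (_ : σ ∈ univ) => key σ
  simp only [sum_add_distrib, sum_sub_distrib, ← mul_sum, hp.2] at h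
  rw [sum_comm, sum_comm (f := fun σ i => p i * (ξ σ + W i σ - _) ^ 2)] at h
  simpa only [brierLoss, mul_sum] using h

/-- The differences of the class indicators have variance at most `1`. -/
lemma sum_mul_sq_sub_le_one {m : ℕ} {p : Fin (m + 1) → ℝ}
    (hp : p ∈ stdSimplex ℝ (Fin (m + 1))) (j : Fin m) :
    ∑ i, p i * ((p j.castSucc - (Pi.single i 1 : Fin (m + 1) → ℝ) j.castSucc) -
      (p (Fin.last m) - (Pi.single i 1 : Fin (m + 1) → ℝ) (Fin.last m))) ^ 2 ≤ 1 := by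
  set v := p j.castSucc - p (Fin.last m)
  set e : Fin (m + 1) → ℝ := fun i => (Pi.single i 1 : Fin (m + 1) → ℝ) j.castSucc -
    (Pi.single i 1 : Fin (m + 1) → ℝ) (Fin.last m) with he
  have hsum : ∑ i, p i * e i = v := by
    simp [he, mul_sub, sum_sub_distrib, Pi.single_apply, v]
  have hle : ∀ i, p i * e i ^ 2 ≤ p i := fun i => by
    have : e i ^ 2 ≤ 1 := by
      simp only [he, Pi.single_apply]
      split_ifs <;> norm_num
    nlinarith [hp.1 i]
  have h1 : ∀ i, p i * ((p j.castSucc - (Pi.single i 1 : Fin (m + 1) → ℝ) j.castSucc) -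
      (p (Fin.last m) - (Pi.single i 1 : Fin (m + 1) → ℝ) (Fin.last m))) ^ 2 =
      p i * e i ^ 2 + p i * v ^ 2 - 2 * v * (p i * e i) := fun i => by simp only [he, v]; ring
  simp only [h1, sum_add_distrib, sum_sub_distrib, ← mul_sum, ← sum_mul, hsum, hp.2]
  have := sum_le_sum fun i (_ : i ∈ univ) => hle i
  rw [hp.2] at this
  nlinarith [sq_nonneg v]

section Ridge

variable {E : Type*} [NormedAddCommGroup E] [InnerProductSpace ℝ E] {m : ℕ}

/-- The regularised cumulative loss over the first `n` trials of the expert `θ`, whose functions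
take the values `⟪θ j, k s⟫` on trial `s`. -/
def ridgeLoss (a : ℝ) (k : ℕ → E) (y : ℕ → Fin (m + 1) → ℝ) (n : ℕ) (θ : Fin m → E) : ℝ :=
  a * ∑ j, ‖θ j‖ ^ 2 + ∑ s ∈ range n, brierLoss (y s) (simplexShift fun j => ⟪θ j, k s⟫)

/-- The normal equations for a minimiser of `ridgeLoss`. -/
def RidgeStationary (a : ℝ) (k : ℕ → E) (y : ℕ → Fin (m + 1) → ℝ) (n : ℕ) (θ : Fin m → E) :
    Prop :=
  ∀ j, a • θ j = ∑ s ∈ range n, (y s j.castSucc - y s (Fin.last m) - ⟪θ j, k s⟫ -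
    ∑ l, ⟪θ l, k s⟫) • k s

lemma RidgeStationary.inner_eq {a : ℝ} {k : ℕ → E} {y : ℕ → Fin (m + 1) → ℝ} {n : ℕ}
    {θ : Fin m → E} (h : RidgeStationary a k y n θ) (j : Fin m) (v : E) :
    a * ⟪θ j, v⟫ = ∑ s ∈ range n, (y s j.castSucc - y s (Fin.last m) - ⟪θ j, k s⟫ -
      ∑ l, ⟪θ l, k s⟫) * ⟪v, k s⟫ := by
  rw [← real_inner_smul_left, h j, sum_inner]
  refine sum_congr rfl fun s _ => ?_
  rw [real_inner_smul_left, real_inner_comm v]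

lemma RidgeStationary.sum_inner_eq {a : ℝ} {k : ℕ → E} {y : ℕ → Fin (m + 1) → ℝ} {n : ℕ}
    {θ : Fin m → E} (h : RidgeStationary a k y n θ) (η : Fin m → E) :
    a * ∑ j, ⟪θ j, η j⟫ = ∑ s ∈ range n, (∑ j, ⟪η j, k s⟫ * (y s j.castSucc - y s (Fin.last m)) -
      ∑ j, ⟪θ j, k s⟫ * ⟪η j, k s⟫ - (∑ j, ⟪θ j, k s⟫) * ∑ j, ⟪η j, k s⟫) := by
  rw [mul_sum]
  simp only [h.inner_eq]
  rw [sum_comm]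
  refine sum_congr rfl fun s _ => ?_
  rw [mul_sum, ← sum_sub_distrib, ← sum_sub_distrib]
  exact sum_congr rfl fun j _ => by ring

lemma RidgeStationary.ridgeLoss_eq {a : ℝ} {k : ℕ → E} {y : ℕ → Fin (m + 1) → ℝ} {n : ℕ}
    {θ : Fin m → E} (h : RidgeStationary a k y n θ) :
    ridgeLoss a k y n θ = ∑ s ∈ range n, (∑ σ, (1 / ((m : ℝ) + 1) - y s σ) ^ 2 -
      ∑ j, ⟪θ j, k s⟫ * (y s j.castSucc - y s (Fin.last m))) := by
  have h1 := h.sum_inner_eq θ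
  simp only [real_inner_self_eq_norm_sq] at h1
  rw [ridgeLoss, h1, ← sum_add_distrib]
  refine sum_congr rfl fun s _ => ?_
  rw [brierLoss_simplexShift]
  simp only [sq]
  ring

lemma RidgeStationary.ridgeLoss_ge {a : ℝ} {k : ℕ → E} {y : ℕ → Fin (m + 1) → ℝ} {n : ℕ}
    {θ : Fin m → E} (h : RidgeStationary a k y n θ) (θ' : Fin m → E) :
    ridgeLoss a k y n θ + a * ∑ j, ‖θ' j - θ j‖ ^ 2 ≤ ridgeLoss a k y n θ' := by
  obtain ⟨η, rfl⟩ : ∃ η, θ' = θ + η := ⟨θ' - θ, by simp⟩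
  have h1 := h.sum_inner_eq η
  have h2 : ∀ j, ‖(θ + η) j‖ ^ 2 = ‖θ j‖ ^ 2 + 2 * ⟪θ j, η j⟫ + ‖η j‖ ^ 2 := fun j =>
    norm_add_sq_real _ _
  have h3 : ∀ s, brierLoss (y s) (simplexShift fun j => ⟪(θ + η) j, k s⟫) =
      brierLoss (y s) (simplexShift fun j => ⟪θ j, k s⟫) -
      2 * (∑ j, ⟪η j, k s⟫ * (y s j.castSucc - y s (Fin.last m)) -
      ∑ j, ⟪θ j, k s⟫ * ⟪η j, k s⟫ - (∑ j, ⟪θ j, k s⟫) * ∑ j, ⟪η j, k s⟫) +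
      (∑ j, ⟪η j, k s⟫ ^ 2 + (∑ j, ⟪η j, k s⟫) ^ 2) := fun s => by
    simp only [brierLoss_simplexShift, Pi.add_apply, inner_add_left, add_sq, add_mul,
      sum_add_distrib, mul_assoc, ← mul_sum]
    ring
  have h4 : 0 ≤ ∑ s ∈ range n, (∑ j, ⟪η j, k s⟫ ^ 2 + (∑ j, ⟪η j, k s⟫) ^ 2) :=
    sum_nonneg fun s _ => by positivity
  simp only [ridgeLoss, h2, h3]
  rw [sum_add_distrib (s := range n), sum_sub_distrib, ← mul_sum (s := range n), ← h1]
  simp only [sum_add_distrib, ← mul_sum, Pi.add_apply, add_sub_cancel_left] at h4 ⊢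
  linarith

/-! ### The normal equations in matrix form -/

/-- The Gram matrix of the first `n` vectors. -/
def gramMatrix (k : ℕ → E) (n : ℕ) : Matrix (Fin n) (Fin n) ℝ :=
  Matrix.of fun s u => ⟪k s, k u⟫

/-- The matrix `I + J` with `2` on the diagonal and `1` elsewhere. -/
def classMatrix (m : ℕ) : Matrix (Fin m) (Fin m) ℝ :=
  Matrix.of fun i j => if i = j then 2 else 1

/-- The matrix `aI + (I + J) ⊗ G` of the normal equations. -/
def ridgeMatrix (m : ℕ) (a : ℝ) (k : ℕ → E) (n : ℕ) : Matrix (Fin m × Fin n) (Fin m × Fin n) ℝ :=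
  a • 1 + classMatrix m ⊗ₖ gramMatrix k n

/-- The expert with coefficients `α`. -/
def kernelExpert (k : ℕ → E) (n : ℕ) (α : Fin m × Fin n → ℝ) : Fin m → E :=
  fun j => ∑ s, α (j, s) • k s

lemma inner_kernelExpert_eq_sum (k : ℕ → E) (n : ℕ) (α : Fin m × Fin n → ℝ) (j : Fin m) (v : E) :
    ⟪v, kernelExpert k n α j⟫ = ∑ s : Fin n, α (j, s) * ⟪v, k s⟫ := by
  simp [kernelExpert, inner_sum, real_inner_smul_right]

lemma inner_kernelExpert (k : ℕ → E) (n : ℕ) (α : Fin m × Fin n → ℝ) (j : Fin m) (s : Fin n) :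
    ⟪kernelExpert k n α j, k s⟫ =
      Matrix.mulVec ((1 : Matrix (Fin m) (Fin m) ℝ) ⊗ₖ gramMatrix k n) α (j, s) := by
  rw [real_inner_comm, inner_kernelExpert_eq_sum]
  simp [Matrix.mulVec, dotProduct, Fintype.sum_prod_type, gramMatrix, Matrix.one_apply, mul_comm]

lemma classMatrix_kronecker_mulVec (k : ℕ → E) (n : ℕ) (α : Fin m × Fin n → ℝ) (j : Fin m)
    (s : Fin n) :
    Matrix.mulVec (classMatrix m ⊗ₖ gramMatrix k n) α (j, s) =
      ⟪kernelExpert k n α j, k s⟫ + ∑ l, ⟪kernelExpert k n α l, k s⟫ := by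
  have h1 : ∀ l, ⟪kernelExpert k n α l, k s⟫ = ∑ u : Fin n, α (l, u) * ⟪k s, k u⟫ := fun l => by
    rw [real_inner_comm, inner_kernelExpert_eq_sum]
  have h2 : ∀ l u, (classMatrix m ⊗ₖ gramMatrix k n) (j, s) (l, u) * α (l, u) =
      (if j = l then α (l, u) * ⟪k s, k u⟫ else 0) + α (l, u) * ⟪k s, k u⟫ := fun l u => by
    simp only [Matrix.kroneckerMap_apply, classMatrix, gramMatrix, Matrix.of_apply]
    split_ifs <;> ring
  simp only [h1, Matrix.mulVec, dotProduct, Fintype.sum_prod_type, h2, sum_add_distrib]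
  rw [sum_comm]
  simp

lemma gramMatrix_transpose (k : ℕ → E) (n : ℕ) : (gramMatrix k n).transpose = gramMatrix k n := by
  ext s u
  simp [gramMatrix, real_inner_comm]

lemma ridgeMatrix_transpose (a : ℝ) (k : ℕ → E) (n : ℕ) :
    (ridgeMatrix m a k n).transpose = ridgeMatrix m a k n := by
  have h : (classMatrix m).transpose = classMatrix m := by
    ext i j
    simp [classMatrix, eq_comm]
  simp [ridgeMatrix, ← Matrix.kroneckerMap_transpose, h, gramMatrix_transpose]

lemma isUnit_ridgeMatrix {a : ℝ} (ha : 0 < a) (k : ℕ → E) (n : ℕ) :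
    IsUnit (ridgeMatrix m a k n) := by
  rw [← Matrix.mulVec_injective_iff_isUnit]
  refine (injective_iff_map_eq_zero (Matrix.mulVecLin (ridgeMatrix m a k n))).2 fun v hv => ?_
  have h0 : v ⬝ᵥ Matrix.mulVec (ridgeMatrix m a k n) v = 0 := by
    rw [← Matrix.mulVecLin_apply, hv, dotProduct_zero]
  have h1 : v ⬝ᵥ Matrix.mulVec (classMatrix m ⊗ₖ gramMatrix k n) v =
      ∑ j, ‖kernelExpert k n v j‖ ^ 2 + ‖∑ j, kernelExpert k n v j‖ ^ 2 := by
    have h2 : ∀ j, ∑ s : Fin n, v (j, s) * ⟪kernelExpert k n v j, k s⟫ =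
        ‖kernelExpert k n v j‖ ^ 2 := fun j => by
      rw [← real_inner_self_eq_norm_sq, inner_kernelExpert_eq_sum]
    have h3 : ∑ j, ∑ s : Fin n, v (j, s) * ∑ l, ⟪kernelExpert k n v l, k s⟫ =
        ‖∑ j, kernelExpert k n v j‖ ^ 2 := by
      rw [← real_inner_self_eq_norm_sq, inner_sum]
      refine sum_congr rfl fun j _ => ?_
      simp only [inner_kernelExpert_eq_sum, sum_inner, mul_sum]
      exact sum_comm
    simp only [dotProduct, Fintype.sum_prod_type, classMatrix_kronecker_mulVec, mul_add,
      sum_add_distrib, h2, h3]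
  rw [ridgeMatrix, Matrix.add_mulVec, dotProduct_add, h1, Matrix.smul_mulVec, Matrix.one_mulVec,
    dotProduct_smul, smul_eq_mul] at h0
  have h4 : 0 ≤ v ⬝ᵥ v := by
    simpa using dotProduct_star_self_nonneg v
  have h5 : v ⬝ᵥ v = 0 := by
    have : 0 ≤ ∑ j, ‖kernelExpert k n v j‖ ^ 2 + ‖∑ j, kernelExpert k n v j‖ ^ 2 := by positivity
    nlinarith
  exact dotProduct_self_eq_zero.1 h5

/-- The right-hand side of the normal equations. -/
def ridgeTarget (y : ℕ → Fin (m + 1) → ℝ) (n : ℕ) : Fin m × Fin n → ℝ :=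
  fun p => y p.2 p.1.castSucc - y p.2 (Fin.last m)

lemma ridgeStationary_kernelExpert {a : ℝ} {k : ℕ → E} {y : ℕ → Fin (m + 1) → ℝ} {n : ℕ}
    {α : Fin m × Fin n → ℝ}
    (h : Matrix.mulVec (ridgeMatrix m a k n) α = ridgeTarget y n) :
    RidgeStationary a k y n (kernelExpert k n α) := by
  intro j
  rw [sum_range, kernelExpert, smul_sum]
  refine sum_congr rfl fun s _ => ?_
  have h1 := congrFun h (j, s)
  rw [ridgeMatrix, Matrix.add_mulVec, Pi.add_apply, classMatrix_kronecker_mulVec,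
    Matrix.smul_mulVec, Matrix.one_mulVec, Pi.smul_apply, smul_eq_mul, ridgeTarget] at h1
  rw [smul_smul]
  congr 1
  simp only at h1
  simp only [kernelExpert] at h1 ⊢
  linarith

/-- The minimiser of the regularised loss. -/
def ridgeSolution (a : ℝ) (k : ℕ → E) (y : ℕ → Fin (m + 1) → ℝ) (n : ℕ) : Fin m → E :=
  kernelExpert k n (Matrix.mulVec (ridgeMatrix m a k n)⁻¹ (ridgeTarget y n))

lemma ridgeStationary_ridgeSolution {a : ℝ} (ha : 0 < a) (k : ℕ → E)
    (y : ℕ → Fin (m + 1) → ℝ) (n : ℕ) : RidgeStationary a k y n (ridgeSolution a k y n) := by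
  apply ridgeStationary_kernelExpert
  rw [Matrix.mulVec_mulVec, Matrix.mul_nonsing_inv _
    ((Matrix.isUnit_iff_isUnit_det _).1 (isUnit_ridgeMatrix ha k n)), Matrix.one_mulVec]

lemma ridgeLoss_ridgeSolution {a : ℝ} (ha : 0 < a) (k : ℕ → E)
    (y : ℕ → Fin (m + 1) → ℝ) (n : ℕ) :
    ridgeLoss a k y n (ridgeSolution a k y n) =
      ∑ s ∈ range n, ∑ σ, (1 / ((m : ℝ) + 1) - y s σ) ^ 2 -
      ridgeTarget y n ⬝ᵥ Matrix.mulVec (((1 : Matrix (Fin m) (Fin m) ℝ) ⊗ₖ gramMatrix k n) *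
        (ridgeMatrix m a k n)⁻¹) (ridgeTarget y n) := by
  rw [(ridgeStationary_ridgeSolution ha k y n).ridgeLoss_eq, sum_sub_distrib, ← Matrix.mulVec_mulVec]
  congr 1
  rw [sum_range, dotProduct, Fintype.sum_prod_type, sum_comm]
  refine sum_congr rfl fun j _ => sum_congr rfl fun s _ => ?_
  rw [ridgeSolution, inner_kernelExpert, mul_comm]
  rfl

/-- The difference of two minima with the same constant terms. -/
lemma dotProduct_mulVec_sub_of_ridge {a : ℝ} (ha : 0 < a) (k : ℕ → E) (n : ℕ)
    (b b' : Fin m × Fin n → ℝ) :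
    b ⬝ᵥ Matrix.mulVec (((1 : Matrix (Fin m) (Fin m) ℝ) ⊗ₖ gramMatrix k n) *
        (ridgeMatrix m a k n)⁻¹) b -
      b' ⬝ᵥ Matrix.mulVec (((1 : Matrix (Fin m) (Fin m) ℝ) ⊗ₖ gramMatrix k n) *
        (ridgeMatrix m a k n)⁻¹) b' =
      (b + b') ⬝ᵥ Matrix.mulVec (ridgeMatrix m a k n)⁻¹
        (Matrix.mulVec ((1 : Matrix (Fin m) (Fin m) ℝ) ⊗ₖ gramMatrix k n) (b - b')) := by
  set P := (1 : Matrix (Fin m) (Fin m) ℝ) ⊗ₖ gramMatrix k n with hP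
  set A := ridgeMatrix m a k n with hA
  have hdet : IsUnit A.det := (Matrix.isUnit_iff_isUnit_det _).1 (isUnit_ridgeMatrix ha k n)
  have hcomm : P * A = A * P := by
    simp [hP, hA, ridgeMatrix, mul_add, add_mul, ← Matrix.mul_kronecker_mul]
  have hcomm' : P * A⁻¹ = A⁻¹ * P := by
    calc P * A⁻¹ = A⁻¹ * (A * P) * A⁻¹ := by
          rw [← mul_assoc A⁻¹, Matrix.nonsing_inv_mul _ hdet, one_mul]
      _ = A⁻¹ * P := by
          rw [← hcomm, mul_assoc, mul_assoc, Matrix.mul_nonsing_inv _ hdet, mul_one]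
  have hsymm : (P * A⁻¹).transpose = P * A⁻¹ := by
    rw [Matrix.transpose_mul, Matrix.transpose_nonsing_inv, ridgeMatrix_transpose, hP,
      ← Matrix.kroneckerMap_transpose, gramMatrix_transpose, Matrix.transpose_one, ← hP, hcomm']
  have hswap : b' ⬝ᵥ Matrix.mulVec (P * A⁻¹) b = b ⬝ᵥ Matrix.mulVec (P * A⁻¹) b' := by
    rw [Matrix.dotProduct_mulVec, ← Matrix.mulVec_transpose, hsymm, dotProduct_comm]
  rw [Matrix.mulVec_mulVec, ← hcomm', Matrix.mulVec_sub, add_dotProduct, dotProduct_sub,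
    dotProduct_sub, hswap]
  ring

end Ridge

section OneStep

variable {E : Type*} [NormedAddCommGroup E] [InnerProductSpace ℝ E] {m : ℕ}

lemma ridgeLoss_update_succ (a : ℝ) (k : ℕ → E) (y : ℕ → Fin (m + 1) → ℝ) (t : ℕ)
    (v : Fin (m + 1) → ℝ) (θ : Fin m → E) :
    ridgeLoss a k (Function.update y t v) (t + 1) θ =
      ridgeLoss a k y t θ + brierLoss v (simplexShift fun j => ⟪θ j, k t⟫) := by
  rw [ridgeLoss, ridgeLoss, sum_range_succ, Function.update_self, add_assoc]
  congr 2
  refine sum_congr rfl fun s hs => ?_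
  rw [Function.update_of_ne (mem_range.1 hs).ne]

lemma simplexShift_add (z w : Fin m → ℝ) (σ : Fin (m + 1)) :
    simplexShift (fun j => z j + w j) σ =
      simplexShift z σ + Fin.snoc (α := fun _ => ℝ) w (-∑ j, w j) σ := by
  refine Fin.lastCases ?_ (fun j => ?_) σ
  · simp [simplexShift_last, sum_add_distrib]
    ring
  · simp [simplexShift_castSucc]
    ring

/-- The minimal regularised loss when the outcome of trial `t` is the vertex `i`. -/
def vertexRidge (a : ℝ) (k : ℕ → E) (y : ℕ → Fin (m + 1) → ℝ) (t : ℕ) (i : Fin (m + 1)) : ℝ :=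
  ridgeLoss a k (Function.update y t (Pi.single i 1)) (t + 1)
    (ridgeSolution a k (Function.update y t (Pi.single i 1)) (t + 1))

lemma neg_le_mul_norm_sq_add {a κ : ℝ} (ha : 0 < a) {v : E} (hv : ‖v‖ ^ 2 ≤ κ) (h : E) (β : ℝ) :
    -(κ / a * β ^ 2) ≤ a * ‖h‖ ^ 2 + 2 * (β * ⟪h, v⟫) := by
  have h1 := norm_add_sq_real h ((β / a) • v)
  rw [real_inner_smul_right, norm_smul, mul_pow, Real.norm_eq_abs, sq_abs] at h1
  have h2 : 0 ≤ a * ‖h + (β / a) • v‖ ^ 2 := by positivity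
  have h3 : a * ‖h + (β / a) • v‖ ^ 2 =
      a * ‖h‖ ^ 2 + 2 * (β * ⟪h, v⟫) + ‖v‖ ^ 2 / a * β ^ 2 := by
    rw [h1]
    field_simp
  have h4 : ‖v‖ ^ 2 / a * β ^ 2 ≤ κ / a * β ^ 2 := by gcongr
  linarith

lemma entropy_le_sum_vertexRidge {a κ : ℝ} (ha : 0 < a) (k : ℕ → E)
    (y : ℕ → Fin (m + 1) → ℝ) (t : ℕ) (hκ : ‖k t‖ ^ 2 ≤ κ) {p : Fin (m + 1) → ℝ}
    (hp : p ∈ stdSimplex ℝ (Fin (m + 1))) :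
    ridgeLoss a k y t (ridgeSolution a k y t) - m * (κ / a) + 1 - ∑ i, p i ^ 2 ≤
      ∑ i, p i * vertexRidge a k y t i := by
  set θ := ridgeSolution a k y t
  set B := ridgeLoss a k y t θ
  set η : Fin (m + 1) → Fin m → E := fun i j =>
    ridgeSolution a k (Function.update y t (Pi.single i 1)) (t + 1) j - θ j with hη
  set β : Fin (m + 1) → Fin m → ℝ := fun i j =>
    (p j.castSucc - (Pi.single i 1 : Fin (m + 1) → ℝ) j.castSucc) -
      (p (Fin.last m) - (Pi.single i 1 : Fin (m + 1) → ℝ) (Fin.last m)) with hβ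
  set W : Fin (m + 1) → Fin (m + 1) → ℝ := fun i =>
    Fin.snoc (α := fun _ => ℝ) (fun j => ⟪η i j, k t⟫) (-∑ j, ⟪η i j, k t⟫) with hW
  have hV : ∀ i, B + a * ∑ j, ‖η i j‖ ^ 2 + brierLoss (Pi.single i 1)
      (fun σ => simplexShift (fun j => ⟪θ j, k t⟫) σ + W i σ) ≤ vertexRidge a k y t i := fun i => by
    rw [vertexRidge, ridgeLoss_update_succ]
    refine add_le_add ((ridgeStationary_ridgeSolution ha k y t).ridgeLoss_ge _) (le_of_eq ?_)
    congr 1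
    ext σ
    rw [hW, ← simplexShift_add]
    simp only [hη, ← inner_add_left, add_sub_cancel]
  have hcross : ∀ i, ∑ σ, (p σ - (Pi.single i 1 : Fin (m + 1) → ℝ) σ) * W i σ =
      ∑ j, β i j * ⟪η i j, k t⟫ := fun i => by
    rw [Fin.sum_univ_castSucc]
    simp only [hW, hβ, Fin.snoc_castSucc, Fin.snoc_last, sub_mul (_ - _), sum_sub_distrib, ← mul_sum]
    ring
  have hent := entropy_le_sum_brierLoss hp (simplexShift fun j => ⟪θ j, k t⟫) W
  simp only [hcross] at hent
  have hpt : ∀ i, -(κ / a * ∑ j, β i j ^ 2) ≤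
      a * ∑ j, ‖η i j‖ ^ 2 + 2 * ∑ j, β i j * ⟪η i j, k t⟫ := fun i => by
    rw [mul_sum, mul_sum, mul_sum, ← sum_add_distrib, ← sum_neg_distrib]
    exact sum_le_sum fun j _ => neg_le_mul_norm_sq_add ha hκ _ _
  have h1 : ∑ i, p i * (B + a * ∑ j, ‖η i j‖ ^ 2 + brierLoss (Pi.single i 1)
      (fun σ => simplexShift (fun j => ⟪θ j, k t⟫) σ + W i σ)) ≤
      ∑ i, p i * vertexRidge a k y t i :=
    sum_le_sum fun i _ => mul_le_mul_of_nonneg_left (hV i) (hp.1 i)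
  have h2 : ∑ i, p i * -(κ / a * ∑ j, β i j ^ 2) ≤
      ∑ i, p i * (a * ∑ j, ‖η i j‖ ^ 2 + 2 * ∑ j, β i j * ⟪η i j, k t⟫) :=
    sum_le_sum fun i _ => mul_le_mul_of_nonneg_left (hpt i) (hp.1 i)
  have h3 : ∑ i, p i * ∑ j, β i j ^ 2 ≤ m := by
    simp only [mul_sum]
    rw [sum_comm]
    calc ∑ j, ∑ i, p i * β i j ^ 2 ≤ ∑ _j : Fin m, (1 : ℝ) :=
          sum_le_sum fun j _ => sum_mul_sq_sub_le_one hp j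
      _ = m := by simp
  have h4 : ∑ i, p i * -(κ / a * ∑ j, β i j ^ 2) = -(κ / a * ∑ i, p i * ∑ j, β i j ^ 2) := by
    rw [mul_sum, ← sum_neg_distrib]
    exact sum_congr rfl fun i _ => by ring
  have h5 : κ / a * ∑ i, p i * ∑ j, β i j ^ 2 ≤ κ / a * m :=
    mul_le_mul_of_nonneg_left h3 (div_nonneg ((sq_nonneg _).trans hκ) ha.le)
  have h6 : ∑ i, p i * (2 * ∑ j, β i j * ⟪η i j, k t⟫) =
      2 * ∑ i, p i * ∑ j, β i j * ⟪η i j, k t⟫ := by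
    rw [mul_sum]
    exact sum_congr rfl fun i _ => by ring
  simp only [mul_add, sum_add_distrib, ← sum_mul, hp.2, one_mul] at h1 h2
  linarith

/-- One trial: predicting by the substitution function from the shifted minima `vertexRidge`. -/
lemma brierLoss_substitution_vertexRidge_le {a κ : ℝ} (ha : 0 < a) (k : ℕ → E)
    (y : ℕ → Fin (m + 1) → ℝ) (t : ℕ) (hκ : ‖k t‖ ^ 2 ≤ κ) (c : ℝ)
    (hy : y t ∈ stdSimplex ℝ (Fin (m + 1))) (θ : Fin m → E) :
    brierLoss (y t) (substitution fun i => vertexRidge a k y t i - c) +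
        ridgeLoss a k y t (ridgeSolution a k y t) ≤
      ridgeLoss a k y (t + 1) θ + m * (κ / a) := by
  set γ := substitution fun i => vertexRidge a k y t i - c
  set B := ridgeLoss a k y t (ridgeSolution a k y t)
  have h1 : ∀ i, brierLoss (Pi.single i 1) γ + (B - m * (κ / a)) ≤ ridgeLoss a k y t θ +
      brierLoss (Pi.single i 1) (simplexShift fun j => ⟪θ j, k t⟫) := fun i => by
    refine (brierLoss_substitution_le _ _ c
      (fun p hp => entropy_le_sum_vertexRidge ha k y t hκ hp) i).trans ?_
    rw [← ridgeLoss_update_succ]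
    refine le_trans ?_ ((ridgeStationary_ridgeSolution ha k _ _).ridgeLoss_ge θ)
    exact le_add_of_nonneg_right (by positivity)
  have h2 := sum_le_sum fun i (_ : i ∈ univ) => mul_le_mul_of_nonneg_left (h1 i) (hy.1 i)
  simp only [mul_add, sum_add_distrib, ← sum_mul, hy.2, one_mul] at h2
  have h3 : ridgeLoss a k y (t + 1) θ =
      ridgeLoss a k y t θ + brierLoss (y t) (simplexShift fun j => ⟪θ j, k t⟫) := by
    rw [← ridgeLoss_update_succ, Function.update_eq_self]
  rw [h3, brierLoss_eq_sum_vertices hy γ, brierLoss_eq_sum_vertices hy (simplexShift _)]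
  linarith

/-- The constant terms of the losses at the vertices coincide, so that differences of the minima
are given by the explicit formula. -/
lemma vertexRidge_sub {a : ℝ} (ha : 0 < a) (k : ℕ → E) (y : ℕ → Fin (m + 1) → ℝ) (t : ℕ)
    (i l : Fin (m + 1)) :
    vertexRidge a k y t i - vertexRidge a k y t l =
      -(ridgeTarget (Function.update y t (Pi.single i 1)) (t + 1) +
        ridgeTarget (Function.update y t (Pi.single l 1)) (t + 1)) ⬝ᵥ
      Matrix.mulVec (ridgeMatrix m a k (t + 1))⁻¹
        (Matrix.mulVec ((1 : Matrix (Fin m) (Fin m) ℝ) ⊗ₖ gramMatrix k (t + 1))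
          (ridgeTarget (Function.update y t (Pi.single i 1)) (t + 1) -
            ridgeTarget (Function.update y t (Pi.single l 1)) (t + 1))) := by
  rw [neg_dotProduct, ← dotProduct_mulVec_sub_of_ridge ha, vertexRidge, vertexRidge,
    ridgeLoss_ridgeSolution ha, ridgeLoss_ridgeSolution ha]
  have h : ∀ i : Fin (m + 1), ∑ s ∈ range (t + 1), ∑ σ, (1 / ((m : ℝ) + 1) -
      Function.update y t (Pi.single i 1) s σ) ^ 2 =
      ∑ s ∈ range t, ∑ σ, (1 / ((m : ℝ) + 1) - y s σ) ^ 2 +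
        (∑ _σ : Fin (m + 1), (1 / ((m : ℝ) + 1)) ^ 2 - 2 * (1 / ((m : ℝ) + 1)) + 1) := fun i => by
    rw [sum_range_succ, Function.update_self,
      ← brierLoss_single i (fun _ => 1 / ((m : ℝ) + 1))]
    congr 1
    refine sum_congr rfl fun s hs => ?_
    rw [Function.update_of_ne (mem_range.1 hs).ne]
  rw [h i, h l]
  ring

end OneStep

lemma abs_apply_le {X : Type*} {H : Type*} [NormedAddCommGroup H] [InnerProductSpace ℝ H]
    [RKHS ℝ H X ℝ] (hc : embeddingConst H ≠ ⊤) (f : H) (x : X) :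
    |f x| ≤ (embeddingConst H).toReal * ‖f‖ := by
  rcases eq_or_ne f 0 with rfl | hf
  · simp
  have hn : 0 < ‖f‖ := norm_pos_iff.2 hf
  have h1 : ENNReal.ofReal |(‖f‖⁻¹ • f) x| ≤ embeddingConst H := by
    refine le_trans ?_ (le_iSup (evalNorm H) x)
    refine le_iSup₂_of_le (‖f‖⁻¹ • f) ?_ le_rfl
    rw [norm_smul, norm_inv, norm_norm, inv_mul_cancel₀ hn.ne']
  have h2 := (ENNReal.ofReal_le_iff_le_toReal hc).1 h1
  rw [RKHS.coe_smul, Pi.smul_apply, smul_eq_mul, abs_mul, abs_inv, abs_norm] at h2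
  rwa [inv_mul_le_iff₀ hn, mul_comm] at h2

section Kernel

variable {X : Type*} {H : Type*} [NormedAddCommGroup H] [InnerProductSpace ℝ H]
    [CompleteSpace H] [RKHS ℝ H X ℝ] {m : ℕ}

/-- The representers of the evaluations at the signals. -/
def signalRep (H : Type*) {X : Type*} [NormedAddCommGroup H] [InnerProductSpace ℝ H]
    [CompleteSpace H] [RKHS ℝ H X ℝ] (x : ℕ → X) (s : ℕ) : H :=
  RKHS.kerFun H (x s) 1

lemma inner_signalRep (x : ℕ → X) (s : ℕ) (f : H) : ⟪f, signalRep H x s⟫ = f (x s) := by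
  simp [signalRep]

lemma inner_signalRep_signalRep (x : ℕ → X) (s u : ℕ) :
    ⟪signalRep H x s, signalRep H x u⟫ = realKernel H (x s) (x u) := by
  have h := RKHS.kernel_inner H (x s) (x u) 1 1
  rw [real_inner_comm, signalRep, signalRep, ← h]
  simp [realKernel]

lemma norm_signalRep_le (hc : embeddingConst H ≠ ⊤) (x : ℕ → X) (s : ℕ) :
    ‖signalRep H x s‖ ^ 2 ≤ (embeddingConst H).toReal ^ 2 := by
  have h := (le_abs_self _).trans (abs_apply_le hc (signalRep H x s) (x s))
  rw [← inner_signalRep, real_inner_self_eq_norm_sq] at h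
  have hc0 : 0 ≤ (embeddingConst H).toReal := ENNReal.toReal_nonneg
  nlinarith [sq_nonneg (‖signalRep H x s‖ - (embeddingConst H).toReal)]

lemma mkaarMatrix_eq_ridgeMatrix (a : ℝ) (x : ℕ → X) (t : ℕ) :
    mkaarMatrix m (realKernel H) a x t = ridgeMatrix m a (signalRep H x) (t + 1) := by
  ext p q
  simp [mkaarMatrix, ridgeMatrix, classMatrix, gramMatrix, inner_signalRep_signalRep]

lemma mkaarCol_eq_mulVec (x : ℕ → X) (y : ℕ → Fin (m + 1) → ℝ) (t : ℕ) (i : Fin m) :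
    mkaarCol (realKernel H) x t i =
      Matrix.mulVec ((1 : Matrix (Fin m) (Fin m) ℝ) ⊗ₖ gramMatrix (signalRep H x) (t + 1))
        (ridgeTarget (Function.update y t (Pi.single i.castSucc 1)) (t + 1) -
          ridgeTarget (Function.update y t (Pi.single (Fin.last m) 1)) (t + 1)) := by
  ext ⟨j, s⟩
  have h1 : ∀ u : Fin t, (u : ℕ) ≠ t := fun u => u.2.ne
  simp only [mkaarCol, Matrix.mulVec, dotProduct, Fintype.sum_prod_type, Matrix.kroneckerMap_apply,
    Pi.sub_apply, ridgeTarget, Fin.sum_univ_castSucc, Fin.val_castSucc, Fin.val_last,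
    Function.update_of_ne (h1 _), Function.update_self, sub_self, mul_zero, sum_const_zero,
    zero_add, gramMatrix, Matrix.of_apply, inner_signalRep_signalRep, Matrix.one_apply,
    Pi.single_apply, Fin.castSucc_inj]
  simp [Fin.castSucc_ne_last, (Fin.castSucc_ne_last _).symm]
  split_ifs <;> ring

lemma mkaarRow_eq_neg_add (y : ℕ → Fin (m + 1) → ℝ) (t : ℕ) (i : Fin m) :
    mkaarRow y t i = -(ridgeTarget (Function.update y t (Pi.single i.castSucc 1)) (t + 1) +
      ridgeTarget (Function.update y t (Pi.single (Fin.last m) 1)) (t + 1)) := by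
  ext ⟨j, s⟩
  rcases (Nat.lt_succ_iff.1 s.2).lt_or_eq with hs | hs
  · simp only [mkaarRow, hs, if_true, Pi.neg_apply, Pi.add_apply, ridgeTarget,
      Function.update_of_ne hs.ne]
    ring
  · simp [mkaarRow, hs, ridgeTarget, Pi.single_apply, Fin.castSucc_ne_last,
      (Fin.castSucc_ne_last _).symm]
    split_ifs <;> norm_num

lemma mkaarShifted_eq {a : ℝ} (ha : 0 < a) (x : ℕ → X) (y : ℕ → Fin (m + 1) → ℝ) (t : ℕ) :
    mkaarShifted (realKernel H) a x y t = fun i => vertexRidge a (signalRep H x) y t i -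
      vertexRidge a (signalRep H x) y t (Fin.last m) := by
  ext i
  refine Fin.lastCases ?_ (fun j => ?_) i
  · simp [mkaarShifted]
  · rw [vertexRidge_sub ha, ← mkaarCol_eq_mulVec, ← mkaarRow_eq_neg_add,
      ← mkaarMatrix_eq_ridgeMatrix, mkaarShifted, Fin.snoc_castSucc]

/-- The regret bound of mKAAR with a fixed ridge parameter. -/
theorem cumLoss_mkaar_le_ridgeLoss (hc : embeddingConst H ≠ ⊤) {a : ℝ} (ha : 0 < a) (x : ℕ → X)
    (y : ℕ → Fin (m + 1) → ℝ) (T : ℕ)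
    (hy : ∀ t < T, y t ∈ stdSimplex ℝ (Fin (m + 1))) (θ : Fin m → H) :
    cumLoss T y (mkaar (realKernel H) a x y) ≤ ridgeLoss a (signalRep H x) y T θ +
      T * (m * ((embeddingConst H).toReal ^ 2 / a)) := by
  induction T generalizing θ with
  | zero =>
    simp only [cumLoss, ridgeLoss, range_zero, sum_empty, CharP.cast_eq_zero, zero_mul, add_zero]
    positivity
  | succ t ih =>
    have h1 := ih (fun s hs => hy s (by omega))
      (ridgeSolution a (signalRep H x) y t)
    have h2 := brierLoss_substitution_vertexRidge_le ha (signalRep H x) y t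
      (norm_signalRep_le hc x t) (vertexRidge a (signalRep H x) y t (Fin.last m))
      (hy t (by omega)) θ
    rw [← mkaarShifted_eq ha] at h2
    rw [cumLoss] at h1 ⊢
    rw [sum_range_succ, mkaar]
    push_cast
    linarith

lemma ridgeLoss_signalRep (a : ℝ) (x : ℕ → X) (y : ℕ → Fin (m + 1) → ℝ) (T : ℕ)
    (f : Fin m → H) :
    ridgeLoss a (signalRep H x) y T f = a * ∑ i, ‖f i‖ ^ 2 +
      cumLoss T y (fun t => expertPrediction (fun i => (f i : X → ℝ)) (x t)) := by
  simp only [ridgeLoss, inner_signalRep]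
  rfl

end Kernel

theorem corollary1 {X : Type*} {H : Type*} [NormedAddCommGroup H] [InnerProductSpace ℝ H]
    [CompleteSpace H] [RKHS ℝ H X ℝ] (hc : embeddingConst H ≠ ⊤)
    (m T : ℕ) (hT : 0 < T) (F : ℝ) (hF : 0 < F) :
    ∃ a : ℝ, 0 < a ∧
      (0 < (embeddingConst H).toReal → 0 < m →
        a = (embeddingConst H).toReal * Real.sqrt ((m : ℝ) * (T : ℝ)) / F) ∧
      ∀ (x : ℕ → X) (y : ℕ → Fin (m + 1) → ℝ),
        (∀ t < T, y t ∈ stdSimplex ℝ (Fin (m + 1))) →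
        ∀ f : Fin m → H, ∑ i, ‖f i‖ ^ 2 ≤ F ^ 2 →
          cumLoss T y (mkaar (realKernel H) a x y) ≤
            cumLoss T y (fun t => expertPrediction (fun i => (f i : X → ℝ)) (x t)) +
              2 * (embeddingConst H).toReal * F * Real.sqrt ((m : ℝ) * (T : ℝ)) := by
  have hTr : (0 : ℝ) < T := Nat.cast_pos.2 hT
  by_cases h : 0 < (embeddingConst H).toReal ∧ 0 < m
  · obtain ⟨hc0, hm⟩ := h
    have hmr : (0 : ℝ) < m := Nat.cast_pos.2 hm
    set c := (embeddingConst H).toReal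
    set q := Real.sqrt ((m : ℝ) * (T : ℝ)) with hq
    have hq0 : 0 < q := Real.sqrt_pos.2 (by positivity)
    have hqq : q ^ 2 = m * T := Real.sq_sqrt (by positivity)
    have ha : 0 < c * q / F := by positivity
    refine ⟨c * q / F, ha, fun _ _ => rfl, fun x y hy f hf => ?_⟩
    have h1 := cumLoss_mkaar_le_ridgeLoss hc ha x y T hy f
    rw [ridgeLoss_signalRep] at h1
    have h2 : c * q / F * ∑ i, ‖f i‖ ^ 2 ≤ c * q / F * F ^ 2 :=
      mul_le_mul_of_nonneg_left hf ha.le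
    have h3 : c * q / F * F ^ 2 = c * F * q := by field_simp
    have h4 : (T : ℝ) * (m * (c ^ 2 / (c * q / F))) = c * F * q := by
      field_simp
      linarith
    linarith
  · refine ⟨1, one_pos, fun h1 h2 => absurd ⟨h1, h2⟩ h, fun x y hy f _ => ?_⟩
    have hm : (m : ℝ) = 0 ∨ (embeddingConst H).toReal = 0 := by
      rcases Nat.eq_zero_or_pos m with h0 | h0
      · exact Or.inl (by simp [h0])
      · exact Or.inr (le_antisymm (not_lt.1 fun h' => h ⟨h', h0⟩) ENNReal.toReal_nonneg)
    have h1 := cumLoss_mkaar_le_ridgeLoss hc one_pos x y T hy 0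
    rw [ridgeLoss_signalRep] at h1
    have hexp : ∀ t, expertPrediction (fun i => ((0 : Fin m → H) i : X → ℝ)) (x t) =
        expertPrediction (fun i => (f i : X → ℝ)) (x t) := fun t => by
      have hval : ∀ i : Fin m, ((0 : Fin m → H) i) (x t) = f i (x t) := fun i => by
        have hc0 := hm.resolve_left (Nat.cast_ne_zero.2 (Fin.pos i).ne')
        have h2 := abs_apply_le hc (f i) (x t)
        rw [hc0, zero_mul] at h2
        rw [abs_nonpos_iff.1 h2]
        simp
      simp only [expertPrediction, hval]
    have hzero : (m : ℝ) * ((embeddingConst H).toReal ^ 2 / 1) = 0 := by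
      rcases hm with h0 | h0 <;> simp [h0]
    rw [show cumLoss T y (fun t => expertPrediction (fun i => ((0 : Fin m → H) i : X → ℝ)) (x t)) =
      cumLoss T y (fun t => expertPrediction (fun i => (f i : X → ℝ)) (x t)) from
        congrArg (cumLoss T y) (funext hexp), hzero] at h1
    simp only [Pi.zero_apply, norm_zero] at h1
    have h5 : 0 ≤ 2 * (embeddingConst H).toReal * F * Real.sqrt ((m : ℝ) * (T : ℝ)) := by
      have := ENNReal.toReal_nonneg (a := embeddingConst H)
      positivity
    simp only [ne_eq, OfNat.ofNat_ne_zero, not_false_eq_true, zero_pow, sum_const_zero, mul_zero,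
      zero_add, add_zero] at h1
    linarith

end
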